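/- Let $\mathcal H=L_2(0,1)$ be the complex Hilbert space, let $\mathcal B(\mathcal H)$ be the algebra of bounded linear operators in $\mathcal H$, and let $S$ be the operator $(Sf)(x)=xf(x)$. For bounded operators put $[A,B]=AB-BA$. An operator $A$ is called nonnegative if $Af\ge 0$ a.e. whenever $f\ge 0$ a.e. An operator $B$ majorises $A$ if $|Af|\le B|f|$ a.e. for all $f\in\mathcal H$, where $|f|(x)=|f(x)|$. An operator is majorisable if some nonnegative bounded operator majorises it. Let $\chi_a$ be the operator of multiplication by the characteristic function of $[a,1]$, and let $$\mathcal A=\{A\in\mathcal B(\mathcal H): A\chi_a=\chi_aA\chi_a\ \text{ for all } a\in[0,1]\}$$ be the algebra of bounded operators that leave invariant the functions supported in $[a,1]$, for every $a\in[0,1]$. **Theorem.** Let $V\in\mathcal A$, and suppose that there is a nonnegative operator $W\in\mathcal A$ with spectral radius $\operatorname{spr}(W)<1$ such that $[S,W]$ majorises $V$. Then the equation $$[S,K]+VK+V=0$$ has a majorisable solution $K\in\mathcal A$. Moreover, $K$ can be chosen in the form $K=\sum_{n=1}^\infty K_n$, the series converging absolutely in the operator norm, where $K_0=I$ and, for all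 $n\ge1$, $K_n\in\mathcal A$, $[S,K_n]=-VK_{n-1}$, and $W^n$ majorises $K_n$. -/

import Mathlib

open MeasureTheory Set
open scoped ENNReal ComplexOrder

namespace VolterraSimilarity

/-- Lebesgue measure on the unit interval `[0,1]`. -/
noncomputable abbrev unitMeasure : Measure ℝ := volume.restrict (Icc (0 : ℝ) 1)

/-- The complex Hilbert space `L₂(0,1)`. -/
abbrev L2 : Type := Lp ℂ 2 unitMeasure

/-- The algebra of bounded linear operators in `L₂(0,1)`. -/
abbrev Op : Type := L2 →L[ℂ] L2

/-- The bounded operator of multiplication by an essentially bounded function `φ`. -/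
noncomputable def mulOp (φ : ℝ → ℂ) (hφ : MemLp φ ∞ unitMeasure) : Op :=
  (ContinuousLinearMap.mul ℂ ℂ).holderL unitMeasure ∞ 2 2 (hφ.toLp φ)

theorem mulOp_apply_ae (φ : ℝ → ℂ) (hφ : MemLp φ ∞ unitMeasure) (f : L2) :
    mulOp φ hφ f =ᵐ[unitMeasure] fun x => φ x * f x := by
  have h1 : mulOp φ hφ f =ᵐ[unitMeasure] fun x => (hφ.toLp φ) x * f x :=
    (ContinuousLinearMap.mul ℂ ℂ).coeFn_holder (hφ.toLp φ) f
  filter_upwards [h1, hφ.coeFn_toLp] with x hx hy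
  rw [hx, hy]

theorem memLp_id : MemLp (fun x : ℝ => (x : ℂ)) ∞ unitMeasure := by
  refine memLp_top_of_bound (by fun_prop) 1 ?_
  filter_upwards [ae_restrict_mem measurableSet_Icc] with x hx
  simpa [abs_of_nonneg hx.1] using hx.2

theorem memLp_indicator (a : ℝ) :
    MemLp ((Icc a 1).indicator (fun _ => (1 : ℂ))) ∞ unitMeasure :=
  (memLp_const 1).indicator measurableSet_Icc

/-- The operator `S` of multiplication by the independent variable, `(Sf)(x) = x f(x)`. -/
noncomputable def S : Op := mulOp (fun x : ℝ => (x : ℂ)) memLp_id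

theorem S_apply_ae (f : L2) : S f =ᵐ[unitMeasure] fun x => (x : ℂ) * f x :=
  mulOp_apply_ae _ _ f

/-- The operator of multiplication by the characteristic function of `[a,1]`. -/
noncomputable def cutoff (a : ℝ) : Op :=
  mulOp ((Icc a 1).indicator (fun _ => (1 : ℂ))) (memLp_indicator a)

theorem cutoff_apply_ae (a : ℝ) (f : L2) :
    cutoff a f =ᵐ[unitMeasure] (Icc a 1).indicator f := by
  filter_upwards [mulOp_apply_ae _ (memLp_indicator a) f] with x hx
  rw [cutoff, hx]
  by_cases h : x ∈ Icc a 1 <;> simp [h]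

theorem cutoff_mul_self (a : ℝ) : cutoff a * cutoff a = cutoff a := by
  ext1 f
  apply Lp.ext
  filter_upwards [cutoff_apply_ae a (cutoff a f), cutoff_apply_ae a f] with x h1 h2
  change cutoff a (cutoff a f) x = cutoff a f x
  rw [h1]
  by_cases h : x ∈ Icc a 1 <;> simp [h2, h]

/-- The commutator `[A,B] = AB - BA`. -/
noncomputable def opComm (A B : Op) : Op := A * B - B * A

/-- `f ∈ H₊`: the function `f` is real and nonnegative almost everywhere. In `ℂ` the relation
`0 ≤ z` means that `z` is real and nonnegative. -/
def IsNonnegFun (f : L2) : Prop := ∀ᵐ x ∂unitMeasure, 0 ≤ f x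

/-- The pointwise absolute value `|f|(x) = |f(x)|`, again an element of `L₂(0,1)`. -/
noncomputable def absFun (f : L2) : L2 := (Lp.memLp f).norm.ofReal.toLp (fun x => ((‖f x‖ : ℝ) : ℂ))

theorem absFun_ae (f : L2) : absFun f =ᵐ[unitMeasure] fun x => ((‖f x‖ : ℝ) : ℂ) :=
  (Lp.memLp f).norm.ofReal.coeFn_toLp

/-- `A` is a nonnegative operator: it maps nonnegative functions to nonnegative functions. -/
def IsNonnegOp (A : Op) : Prop := ∀ f : L2, IsNonnegFun f → IsNonnegFun (A f)

/-- `B` majorises `A`: `|Af| ≤ B|f|` for all `f`. -/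
def Majorises (B A : Op) : Prop := ∀ f : L2, IsNonnegFun (B (absFun f) - absFun (A f))

/-- `A` is majorisable: some nonnegative bounded operator majorises it. -/
def IsMajorisable (A : Op) : Prop := ∃ B : Op, IsNonnegOp B ∧ Majorises B A

/-- The algebra `𝒜` of bounded operators `A` with `A χ_a = χ_a A χ_a` for all `a ∈ [0,1]`. -/
noncomputable def volterraAlgebra : Subalgebra ℂ Op where
  carrier := {A | ∀ a ∈ Icc (0 : ℝ) 1, A * cutoff a = cutoff a * A * cutoff a}
  mul_mem' := by
    intro A B hA hB a ha
    have h1 := hA a ha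
    have h2 := hB a ha
    calc A * B * cutoff a = A * cutoff a * (B * cutoff a) := by
            rw [mul_assoc A (cutoff a), ← mul_assoc (cutoff a) B, ← h2, mul_assoc]
      _ = cutoff a * A * (cutoff a * B * cutoff a) := by rw [h1]; simp only [mul_assoc]
      _ = cutoff a * (A * B) * cutoff a := by rw [← h2]; simp only [mul_assoc]
  add_mem' := by
    intro A B hA hB a ha
    rw [add_mul, mul_add, add_mul, hA a ha, hB a ha]
  algebraMap_mem' := by
    intro c a _
    rw [← Algebra.commutes c (cutoff a), mul_assoc, cutoff_mul_self]

end VolterraSimilarity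

open VolterraSimilarity

namespace VolterraSimilarity

open Filter Topology

/-! ### The order on `L₂(0,1)` -/

/-! The core is solving `[S, K] = Q` when `[S, W]` majorises `Q` and `W ≥ 0` (`exists_opComm_eq`).
Formally the kernel of `K` is `Q(x,y)/(x - y)`; expanding `1/((1+x) - (1+y))` geometrically gives `K
= ∑ (1+S)⁻⁽ᵏ⁺¹⁾ Q (1+S)ᵏ`. For `Q = [S, W]` the terms telescope to differences of `Wₙ = (1+S)⁻ⁿ W
(1+S)ⁿ`, so `Wₙ f` decreases for `f ≥ 0` and converges in `L₂`. By majorisation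
(`conjPow_sub_majorises`) the series for `Q` converges strongly, and `W` majorises its sum. As `[S,
·]` is a derivation, `[S, Wⁿ⁺¹]` majorises `V Kₙ` whenever `Wⁿ` majorises `Kₙ`, so the `Kₙ` arise by
iteration (`exists_next_term`). Then `‖Kₙ‖ ≤ ‖Wⁿ‖`, summable by Gelfand's formula. -/

theorem isNonnegFun_iff (f : L2) : IsNonnegFun f ↔ 0 ≤ f := Lp.coeFn_nonneg f

theorem majorises_iff {A B : Op} : Majorises B A ↔ ∀ f, absFun (A f) ≤ B (absFun f) := by
  simp only [Majorises, isNonnegFun_iff, sub_nonneg]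

theorem isNonnegOp_iff {A : Op} : IsNonnegOp A ↔ ∀ f, 0 ≤ f → 0 ≤ A f := by
  simp only [IsNonnegOp, isNonnegFun_iff]

theorem absFun_nonneg (f : L2) : 0 ≤ absFun f := by
  rw [← isNonnegFun_iff]
  filter_upwards [absFun_ae f] with x hx
  rw [hx]
  exact_mod_cast norm_nonneg _

theorem absFun_of_nonneg {f : L2} (hf : 0 ≤ f) : absFun f = f := by
  apply Lp.ext
  filter_upwards [absFun_ae f, (isNonnegFun_iff f).2 hf] with x hx h
  rw [hx, Complex.norm_of_nonneg' h]

theorem norm_absFun (f : L2) : ‖absFun f‖ = ‖f‖ := by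
  apply le_antisymm <;> apply Lp.norm_le_norm_of_ae_le <;>
    filter_upwards [absFun_ae f] with x hx <;> simp [hx]

theorem absFun_add_le (f g : L2) : absFun (f + g) ≤ absFun f + absFun g := by
  rw [← Lp.coeFn_le]
  filter_upwards [absFun_ae f, absFun_ae g, absFun_ae (f + g), Lp.coeFn_add f g,
    Lp.coeFn_add (absFun f) (absFun g)] with x h1 h2 h3 h4 h5
  rw [h5, Pi.add_apply, h3, h4, h1, h2, Pi.add_apply]
  exact_mod_cast norm_add_le _ _

theorem absFun_neg (f : L2) : absFun (-f) = absFun f := by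
  apply Lp.ext
  filter_upwards [absFun_ae f, absFun_ae (-f), Lp.coeFn_neg f] with x h1 h2 h3
  rw [h1, h2, h3, Pi.neg_apply, norm_neg]

theorem norm_absFun_sub_le (f g : L2) : ‖absFun f - absFun g‖ ≤ ‖f - g‖ := by
  apply Lp.norm_le_norm_of_ae_le
  filter_upwards [absFun_ae f, absFun_ae g, Lp.coeFn_sub f g,
    Lp.coeFn_sub (absFun f) (absFun g)] with x h1 h2 h3 h4
  rw [h4, h3, Pi.sub_apply, Pi.sub_apply, h1, h2, ← Complex.ofReal_sub, Complex.norm_real]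
  exact abs_norm_sub_norm_le _ _

theorem continuous_absFun : Continuous absFun :=
  (LipschitzWith.of_dist_le_mul (K := 1) fun f g => by
    simpa [dist_eq_norm] using norm_absFun_sub_le f g).continuous

theorem norm_le_of_absFun_le {f g : L2} (h : absFun f ≤ g) : ‖f‖ ≤ ‖g‖ := by
  apply Lp.norm_le_norm_of_ae_le
  filter_upwards [absFun_ae f, (Lp.coeFn_le _ _).2 h] with x h1 h2
  rw [h1] at h2
  exact (Complex.le_def.1 h2).1.trans (Complex.re_le_norm _)

theorem re_inner_nonneg {f g : L2} (hf : 0 ≤ f) (hg : 0 ≤ g) :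
    0 ≤ RCLike.re (inner ℂ f g) := by
  rw [L2.inner_def]
  refine (RCLike.nonneg_iff.1 (integral_nonneg_of_ae ?_)).1
  filter_upwards [(isNonnegFun_iff f).2 hf, (isNonnegFun_iff g).2 hg] with x h1 h2
  rw [RCLike.inner_apply]
  exact mul_nonneg h2 (star_nonneg_iff.2 h1)

/-- The cross term `2 Re ⟪f - g, g⟫` in `‖(f - g) + g‖²` is nonnegative. Hence for monotone
sequences convergence of the norms forces convergence of the vectors. -/
theorem norm_sub_sq_le {f g : L2} (hg : 0 ≤ g) (hfg : g ≤ f) :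
    ‖f - g‖ ^ 2 ≤ ‖f‖ ^ 2 - ‖g‖ ^ 2 := by
  have h := norm_add_sq (𝕜 := ℂ) (f - g) g
  rw [sub_add_cancel] at h
  linarith [re_inner_nonneg (sub_nonneg.2 hfg) hg]

/-- A decreasing sequence of nonnegative elements of `L₂` converges in norm. -/
theorem cauchySeq_of_antitone {u : ℕ → L2} (hu : Antitone u) (h0 : ∀ n, 0 ≤ u n) :
    CauchySeq u := by
  have hanti : Antitone fun n => ‖u n‖ ^ 2 := fun m n hmn => by
    have := norm_sub_sq_le (h0 n) (hu hmn)
    have := sq_nonneg ‖u m - u n‖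
    simp only
    linarith
  have hlim := tendsto_atTop_ciInf hanti ⟨0, by rintro _ ⟨n, rfl⟩; positivity⟩
  rw [Metric.cauchySeq_iff']
  intro ε hε
  obtain ⟨N, hN⟩ := Metric.cauchySeq_iff'.1 hlim.cauchySeq (ε ^ 2) (by positivity)
  refine ⟨N, fun n hn => ?_⟩
  have h1 := norm_sub_sq_le (h0 n) (hu hn)
  have h2 := hN n hn
  rw [Real.dist_eq, abs_sub_comm] at h2
  rw [dist_comm, dist_eq_norm]
  exact lt_of_pow_lt_pow_left₀ 2 hε.le (h1.trans_lt ((le_abs_self _).trans_lt h2))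

/-! ### Majorisation -/

theorem IsNonnegOp.mono {A : Op} (hA : IsNonnegOp A) {f g : L2} (h : f ≤ g) : A f ≤ A g := by
  rw [isNonnegOp_iff] at hA
  simpa using hA _ (sub_nonneg.2 h)

theorem IsNonnegOp.one : IsNonnegOp 1 := fun _ hf => hf

theorem IsNonnegOp.mul {A B : Op} (hA : IsNonnegOp A) (hB : IsNonnegOp B) :
    IsNonnegOp (A * B) := fun f hf => hA _ (hB f hf)

theorem IsNonnegOp.add {A B : Op} (hA : IsNonnegOp A) (hB : IsNonnegOp B) :
    IsNonnegOp (A + B) := by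
  rw [isNonnegOp_iff] at *
  exact fun f hf => add_nonneg (hA f hf) (hB f hf)

theorem IsNonnegOp.zero : IsNonnegOp 0 :=
  isNonnegOp_iff.2 fun _ _ => le_rfl

theorem IsNonnegOp.pow {A : Op} (hA : IsNonnegOp A) (n : ℕ) : IsNonnegOp (A ^ n) := by
  induction n with
  | zero => exact IsNonnegOp.one
  | succ n ih => rw [pow_succ]; exact ih.mul hA

theorem IsNonnegOp.of_tendsto {A : ℕ → Op} {B : Op} (hA : ∀ n, IsNonnegOp (A n))
    (h : ∀ f, Tendsto (fun n => A n f) atTop (𝓝 (B f))) : IsNonnegOp B := by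
  simp only [isNonnegOp_iff] at *
  exact fun f hf => ge_of_tendsto' (h f) fun n => hA n f hf

/-- If `f ≥ 0` then `|f| = f`, so `0 ≤ |Af| ≤ Bf`. -/
theorem Majorises.isNonnegOp {A B : Op} (h : Majorises B A) : IsNonnegOp B := by
  rw [isNonnegOp_iff]
  rw [majorises_iff] at h
  intro f hf
  have := h f
  rw [absFun_of_nonneg hf] at this
  exact (absFun_nonneg _).trans this

theorem Majorises.one : Majorises 1 1 := majorises_iff.2 fun _ => le_rfl

theorem Majorises.zero : Majorises 0 0 :=
  majorises_iff.2 fun _ => by simp [absFun_of_nonneg le_rfl]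

theorem Majorises.mul {A B A' B' : Op} (h : Majorises B A) (h' : Majorises B' A') :
    Majorises (B * B') (A * A') := by
  have hB := h.isNonnegOp
  rw [majorises_iff] at *
  exact fun f => (h (A' f)).trans (hB.mono (h' f))

theorem Majorises.add {A B A' B' : Op} (h : Majorises B A) (h' : Majorises B' A') :
    Majorises (B + B') (A + A') := by
  rw [majorises_iff] at *
  exact fun f => (absFun_add_le _ _).trans (add_le_add (h f) (h' f))

theorem Majorises.neg {A B : Op} (h : Majorises B A) : Majorises B (-A) := by
  rw [majorises_iff] at *
  intro f
  rw [neg_apply, absFun_neg]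
  exact h f

theorem Majorises.add_nonneg {A B C : Op} (h : Majorises B A) (hC : IsNonnegOp C) :
    Majorises (B + C) A := by
  rw [majorises_iff] at *
  rw [isNonnegOp_iff] at hC
  exact fun f => (h f).trans (le_add_of_nonneg_right (hC _ (absFun_nonneg f)))

theorem Majorises.pow {A B : Op} (h : Majorises B A) (n : ℕ) : Majorises (B ^ n) (A ^ n) := by
  induction n with
  | zero => exact Majorises.one
  | succ n ih => rw [pow_succ, pow_succ]; exact ih.mul h

theorem Majorises.sum {A B : ℕ → Op} {s : Finset ℕ} (h : ∀ n ∈ s, Majorises (B n) (A n)) :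
    Majorises (∑ n ∈ s, B n) (∑ n ∈ s, A n) := by
  induction s using Finset.cons_induction with
  | empty => exact Majorises.zero
  | cons a s ha ih =>
    rw [Finset.sum_cons, Finset.sum_cons]
    exact (h a (by simp)).add (ih fun n hn => h n (by simp [hn]))

theorem Majorises.norm_apply_le {A B : Op} (h : Majorises B A) (f : L2) :
    ‖A f‖ ≤ ‖B (absFun f)‖ :=
  norm_le_of_absFun_le (majorises_iff.1 h f)

theorem Majorises.norm_le {A B : Op} (h : Majorises B A) : ‖A‖ ≤ ‖B‖ :=
  A.opNorm_le_bound (norm_nonneg _) fun f =>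
    (h.norm_apply_le f).trans (by simpa [norm_absFun] using B.le_opNorm (absFun f))

/-- Strong convergence suffices: `|·|` is continuous on `L₂` and the order is closed. -/
theorem Majorises.of_tendsto {A B : ℕ → Op} {A' B' : Op} (h : ∀ n, Majorises (B n) (A n))
    (hA : ∀ f, Tendsto (fun n => A n f) atTop (𝓝 (A' f)))
    (hB : ∀ f, Tendsto (fun n => B n f) atTop (𝓝 (B' f))) : Majorises B' A' := by
  simp only [majorises_iff] at *
  exact fun f => le_of_tendsto_of_tendsto' ((continuous_absFun.tendsto _).comp (hA f))
    (hB (absFun f)) fun n => h n f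

/-! ### The Volterra algebra and multiplication operators -/

theorem mem_volterraAlgebra_iff {A : Op} : A ∈ volterraAlgebra ↔
    ∀ a ∈ Icc (0 : ℝ) 1, A * cutoff a = cutoff a * A * cutoff a := Iff.rfl

theorem mem_volterraAlgebra_of_tendsto {A : ℕ → Op} {B : Op} (hA : ∀ n, A n ∈ volterraAlgebra)
    (h : ∀ f, Tendsto (fun n => A n f) atTop (𝓝 (B f))) : B ∈ volterraAlgebra := by
  rw [mem_volterraAlgebra_iff]
  intro a ha
  ext1 f
  refine tendsto_nhds_unique (h (cutoff a f)) ?_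
  refine Tendsto.congr (fun n => ?_) (((cutoff a).continuous.tendsto _).comp (h (cutoff a f)))
  exact (DFunLike.congr_fun (mem_volterraAlgebra_iff.1 (hA n) a ha) f).symm

theorem mulOp_mul_comm (φ ψ : ℝ → ℂ) (hφ : MemLp φ ∞ unitMeasure) (hψ : MemLp ψ ∞ unitMeasure) :
    mulOp φ hφ * mulOp ψ hψ = mulOp ψ hψ * mulOp φ hφ := by
  ext1 f
  apply Lp.ext
  filter_upwards [mulOp_apply_ae φ hφ f, mulOp_apply_ae ψ hψ f,
    mulOp_apply_ae φ hφ (mulOp ψ hψ f), mulOp_apply_ae ψ hψ (mulOp φ hφ f)] with x h1 h2 h3 h4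
  change mulOp φ hφ (mulOp ψ hψ f) x = mulOp ψ hψ (mulOp φ hφ f) x
  rw [h3, h4, h1, h2]
  ring

theorem mulOp_mem_volterraAlgebra (φ : ℝ → ℂ) (hφ : MemLp φ ∞ unitMeasure) :
    mulOp φ hφ ∈ volterraAlgebra := by
  rw [mem_volterraAlgebra_iff]
  intro a _
  have h : mulOp φ hφ * cutoff a = cutoff a * mulOp φ hφ := mulOp_mul_comm _ _ _ _
  rw [← h, mul_assoc, cutoff_mul_self]

theorem mulOp_majorises_self (φ : ℝ → ℂ) (hφ : MemLp φ ∞ unitMeasure)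
    (h : ∀ᵐ x ∂unitMeasure, 0 ≤ φ x) : Majorises (mulOp φ hφ) (mulOp φ hφ) := by
  rw [majorises_iff]
  intro f
  rw [← Lp.coeFn_le]
  filter_upwards [h, mulOp_apply_ae φ hφ f, mulOp_apply_ae φ hφ (absFun f), absFun_ae f,
    absFun_ae (mulOp φ hφ f)] with x h1 h2 h3 h4 h5
  rw [h5, h3, h2, h4, norm_mul, Complex.ofReal_mul, Complex.norm_of_nonneg' h1]

theorem memLp_inv_one_add : MemLp (fun x : ℝ => (((1 + x)⁻¹ : ℝ) : ℂ)) ∞ unitMeasure := by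
  refine memLp_top_of_bound (by fun_prop) 1 ?_
  filter_upwards [ae_restrict_mem measurableSet_Icc] with x hx
  have h0 : 0 ≤ x := hx.1
  rw [Complex.norm_real, Real.norm_of_nonneg (by positivity)]
  exact inv_le_one_of_one_le₀ (by linarith)

/-- The inverse of `1 + S`. -/
noncomputable def resolvent : Op := mulOp (fun x : ℝ => (((1 + x)⁻¹ : ℝ) : ℂ)) memLp_inv_one_add

theorem S_majorises_self : Majorises S S :=
  mulOp_majorises_self _ _ <| by
    filter_upwards [ae_restrict_mem measurableSet_Icc] with x hx
    exact_mod_cast hx.1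

theorem resolvent_majorises_self : Majorises resolvent resolvent :=
  mulOp_majorises_self _ _ <| by
    filter_upwards [ae_restrict_mem measurableSet_Icc] with x hx
    have h0 : 0 ≤ x := hx.1
    have : 0 ≤ (1 + x)⁻¹ := by positivity
    exact_mod_cast this

theorem resolvent_mul : resolvent * (1 + S) = 1 := by
  ext1 f
  apply Lp.ext
  filter_upwards [ae_restrict_mem measurableSet_Icc, Lp.coeFn_add f (S f), S_apply_ae f,
    mulOp_apply_ae _ memLp_inv_one_add (f + S f)] with x hx h1 h2 h3
  change resolvent (f + S f) x = f x
  rw [resolvent, h3, h1, Pi.add_apply, h2]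
  have h0 : (1 + x : ℂ) ≠ 0 := by
    have : (1 + x : ℝ) ≠ 0 := by linarith [hx.1]
    exact_mod_cast this
  push_cast
  field_simp

theorem mul_resolvent : (1 + S) * resolvent = 1 := by
  have h : S * resolvent = resolvent * S := mulOp_mul_comm _ _ _ _
  refine Eq.trans ?_ resolvent_mul
  rw [add_mul, mul_add, one_mul, mul_one, h]

/-! ### The equation `[S, K] = Q` -/

/-- Lets `S` be replaced by `1 + S`, which has a bounded nonnegative inverse. -/
theorem opComm_one_add (A : Op) : opComm (1 + S) A = opComm S A := by
  simp only [opComm]; noncomm_ring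

/-- Conjugation by powers of `1 + S`. -/
noncomputable def conjPow (A : Op) (n : ℕ) : Op := resolvent ^ n * A * (1 + S) ^ n

/-- The partial sums of the series `∑ (1 + S)⁻⁽ⁿ⁺¹⁾ Q (1 + S)ⁿ`, which solves `[S, K] = Q`. -/
noncomputable def commSum (Q : Op) (n : ℕ) : Op :=
  ∑ k ∈ Finset.range n, resolvent * conjPow Q k

theorem conjPow_zero (A : Op) : conjPow A 0 = A := by simp [conjPow]

theorem conjPow_succ (A : Op) (n : ℕ) :
    conjPow A (n + 1) = resolvent * conjPow A n * (1 + S) := by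
  simp only [conjPow, pow_succ' resolvent, pow_succ (1 + S), mul_assoc]

theorem resolvent_mul_conjPow_opComm (W : Op) (n : ℕ) :
    resolvent * conjPow (opComm S W) n = conjPow W n - conjPow W (n + 1) := by
  have hl : Commute (resolvent ^ n) (1 + S) :=
    Commute.pow_left (show resolvent * (1 + S) = (1 + S) * resolvent by
      rw [resolvent_mul, mul_resolvent]) n
  have hr : Commute ((1 + S) ^ n) (1 + S) := (Commute.refl (1 + S)).pow_left n
  have h : conjPow (opComm S W) n = (1 + S) * conjPow W n - conjPow W n * (1 + S) := by
    rw [← opComm_one_add, opComm]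
    simp only [conjPow, mul_sub, sub_mul]
    congr 1
    · rw [← mul_assoc, hl.eq]; simp only [mul_assoc]
    · simp only [mul_assoc]; rw [hr.eq]
  rw [h, mul_sub, ← mul_assoc, resolvent_mul, one_mul, conjPow_succ, mul_assoc]

theorem conjPow_opComm (W : Op) (n : ℕ) :
    conjPow (opComm S W) n = (1 + S) * (conjPow W n - conjPow W (n + 1)) := by
  rw [← resolvent_mul_conjPow_opComm, ← mul_assoc, mul_resolvent, one_mul]

theorem opComm_commSum (Q : Op) (n : ℕ) : opComm S (commSum Q n) = Q - conjPow Q n := by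
  rw [← opComm_one_add, opComm, commSum, Finset.mul_sum, Finset.sum_mul, ← Finset.sum_sub_distrib]
  simp only [← mul_assoc (1 + S), mul_resolvent, one_mul, ← conjPow_succ]
  rw [Finset.sum_range_sub', conjPow_zero]

theorem one_add_S_majorises_self : Majorises (1 + S) (1 + S) := Majorises.one.add S_majorises_self

theorem Majorises.conjPow {A B : Op} (h : Majorises B A) (n : ℕ) :
    Majorises (conjPow B n) (conjPow A n) :=
  ((resolvent_majorises_self.pow n).mul h).mul (one_add_S_majorises_self.pow n)

theorem IsNonnegOp.conjPow {A : Op} (h : IsNonnegOp A) (n : ℕ) : IsNonnegOp (conjPow A n) :=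
  ((resolvent_majorises_self.isNonnegOp.pow n).mul h).mul
    (one_add_S_majorises_self.isNonnegOp.pow n)

/-- Each term of the series for `Q` is majorised by the corresponding term for `[S, W]`, and the
latter telescope. -/
theorem conjPow_sub_majorises {Q W : Op} (h : Majorises (opComm S W) Q) {m n : ℕ} (hmn : m ≤ n) :
    Majorises (conjPow W m - conjPow W n) (commSum Q n - commSum Q m) := by
  have h1 : commSum Q n - commSum Q m = ∑ k ∈ Finset.Ico m n, resolvent * conjPow Q k :=
    (Finset.sum_Ico_eq_sub _ hmn).symm
  have h2 : VolterraSimilarity.conjPow W m - VolterraSimilarity.conjPow W n =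
      ∑ k ∈ Finset.Ico m n, resolvent * VolterraSimilarity.conjPow (opComm S W) k := by
    simp only [resolvent_mul_conjPow_opComm]
    rw [← neg_inj, ← Finset.sum_neg_distrib]
    simp only [neg_sub]
    rw [Finset.sum_Ico_sub _ hmn]
  rw [h1, h2]
  exact Majorises.sum fun k _ => resolvent_majorises_self.mul (h.conjPow k)

theorem commSum_mem {Q : Op} (hQ : Q ∈ volterraAlgebra) (n : ℕ) : commSum Q n ∈ volterraAlgebra :=
  have hS : S ∈ volterraAlgebra := mulOp_mem_volterraAlgebra _ _
  have hR : resolvent ∈ volterraAlgebra := mulOp_mem_volterraAlgebra _ _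
  sum_mem fun k _ => mul_mem hR
    (mul_mem (mul_mem (pow_mem hR k) hQ) (pow_mem (add_mem (one_mem _) hS) k))

theorem cauchySeq_conjPow {W Q : Op} (hW : IsNonnegOp W) (h : Majorises (opComm S W) Q)
    {f : L2} (hf : 0 ≤ f) : CauchySeq fun n => conjPow W n f := by
  refine cauchySeq_of_antitone (fun m n hmn => ?_) fun n => isNonnegOp_iff.1 (hW.conjPow n) f hf
  have := isNonnegOp_iff.1 (conjPow_sub_majorises h hmn).isNonnegOp f hf
  simpa using this

theorem exists_opComm_eq {W Q : Op} (hW : IsNonnegOp W) (hQ : Q ∈ volterraAlgebra)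
    (h : Majorises (opComm S W) Q) :
    ∃ K ∈ volterraAlgebra, opComm S K = Q ∧ Majorises W K := by
  have hcauchy : ∀ f, CauchySeq fun n => commSum Q n f := by
    intro f
    rw [Metric.cauchySeq_iff']
    intro ε hε
    obtain ⟨N, hN⟩ := Metric.cauchySeq_iff'.1
      (cauchySeq_conjPow hW h (absFun_nonneg f)) ε hε
    refine ⟨N, fun n hn => ?_⟩
    have h1 := (conjPow_sub_majorises h hn).norm_apply_le f
    rw [dist_eq_norm]
    refine lt_of_le_of_lt h1 ?_
    have := hN n hn
    rwa [dist_comm, dist_eq_norm] at this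
  choose k hk using fun f => cauchySeq_tendsto_of_complete (hcauchy f)
  -- Boundedness of the strong limit is Banach–Steinhaus.
  let K : Op := continuousLinearMapOfTendsto (commSum Q) (tendsto_pi_nhds.2 hk)
  have hK : ∀ f, Tendsto (fun n => commSum Q n f) atTop (𝓝 (K f)) := hk
  refine ⟨K, mem_volterraAlgebra_of_tendsto (commSum_mem hQ) hK, ?_, ?_⟩
  -- The remainder in `opComm_commSum` vanishes: its majorant is `1 + S` applied to consecutive
  -- differences of a convergent sequence.
  · have hzero : ∀ f, Tendsto (fun n => conjPow Q n f) atTop (𝓝 0) := by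
      intro f
      obtain ⟨g, hg⟩ := cauchySeq_tendsto_of_complete (cauchySeq_conjPow hW h (absFun_nonneg f))
      have h1 : Tendsto (fun n => conjPow (opComm S W) n (absFun f)) atTop (𝓝 0) := by
        have := ((1 + S : Op).continuous.tendsto _).comp
          (hg.sub (hg.comp (tendsto_add_atTop_nat 1)))
        rw [sub_self, map_zero] at this
        exact this.congr fun n => by rw [conjPow_opComm]; rfl
      exact squeeze_zero_norm (fun n => (h.conjPow n).norm_apply_le f)
        (by simpa using h1.norm)
    ext1 f
    have h1 : Tendsto (fun n => opComm S (commSum Q n) f) atTop (𝓝 (opComm S K f)) :=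
      ((S.continuous.tendsto _).comp (hK f)).sub (hK (S f))
    refine tendsto_nhds_unique h1 ?_
    simp only [opComm_commSum, sub_apply]
    simpa using tendsto_const_nhds.sub (hzero f)
  · refine Majorises.of_tendsto (A := commSum Q) (B := fun _ => W) (fun n => ?_) hK
      fun f => tendsto_const_nhds
    -- With `m = 0` the majorant is `W - conjPow W n`; adding back the nonnegative `conjPow W n`
    -- leaves `W`.
    simpa [commSum, conjPow_zero] using
      (conjPow_sub_majorises h (Nat.zero_le n)).add_nonneg (hW.conjPow n)

/-! ### Iteration -/

theorem opComm_mul (A B : Op) : opComm S (A * B) = opComm S A * B + A * opComm S B := by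
  simp only [opComm]; noncomm_ring

theorem isNonnegOp_opComm_pow {W : Op} (hW : IsNonnegOp W) (h : IsNonnegOp (opComm S W)) (n : ℕ) :
    IsNonnegOp (opComm S (W ^ n)) := by
  induction n with
  | zero => simpa [opComm] using IsNonnegOp.zero
  | succ n ih =>
    rw [pow_succ', opComm_mul]
    exact (h.mul (hW.pow n)).add (hW.mul ih)

theorem exists_next_term {V W A : Op} {n : ℕ} (hV : V ∈ volterraAlgebra) (hW : IsNonnegOp W)
    (hmaj : Majorises (opComm S W) V) (hA : A ∈ volterraAlgebra) (hWA : Majorises (W ^ n) A) :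
    ∃ B : Op, (B ∈ volterraAlgebra ∧ Majorises (W ^ (n + 1)) B) ∧ opComm S B = -(V * A) := by
  have h : Majorises (opComm S (W ^ (n + 1))) (-(V * A)) := by
    -- `[S, W] Wⁿ` already majorises `V A`; the other summand `W [S, Wⁿ]` is nonnegative.
    rw [pow_succ', opComm_mul]
    exact ((hmaj.mul hWA).add_nonneg
      (hW.mul (isNonnegOp_opComm_pow hW hmaj.isNonnegOp n))).neg
  obtain ⟨B, hB, hB', hB''⟩ := exists_opComm_eq (hW.pow _) (neg_mem (mul_mem hV hA)) h
  exact ⟨B, ⟨hB, hB''⟩, hB'⟩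

/-- Powers of an element of a complex Banach algebra with spectral radius less than one are
absolutely summable. -/
theorem summable_norm_pow_of_spectralRadius_lt_one {A : Type*} [NormedRing A] [NormedAlgebra ℂ A]
    [CompleteSpace A] {a : A} (h : spectralRadius ℂ a < 1) : Summable fun n => ‖a ^ n‖ := by
  -- By Gelfand's formula `‖aⁿ‖ < rⁿ` eventually.
  obtain ⟨r, hr, hr1⟩ := ENNReal.lt_iff_exists_nnreal_btwn.1 h
  have hr1' : r < 1 := by exact_mod_cast hr1
  have hev := (spectrum.pow_nnnorm_pow_one_div_tendsto_nhds_spectralRadius a).eventually_lt_const hr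
  refine Summable.of_norm_bounded_eventually_nat
    (summable_geometric_of_lt_one r.coe_nonneg (by exact_mod_cast hr1')) ?_
  filter_upwards [hev, eventually_gt_atTop 0] with n hn hn0
  have hn0' : (0 : ℝ) < n := by exact_mod_cast hn0
  rw [one_div, ENNReal.rpow_inv_lt_iff hn0', ENNReal.rpow_natCast] at hn
  rw [norm_norm]
  exact_mod_cast hn.le

end VolterraSimilarity

theorem theorem3p3 (V W : Op) (hV : V ∈ volterraAlgebra)
    (hW : W ∈ volterraAlgebra) (hWnonneg : IsNonnegOp W)
    (hspr : spectralRadius ℂ W < 1)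
    (hmaj : Majorises (opComm S W) V) :
    ∃ K : Op, K ∈ volterraAlgebra ∧ IsMajorisable K ∧ opComm S K + V * K + V = 0 ∧
      ∃ Kn : ℕ → Op, Kn 0 = 1 ∧
        (∀ n, Kn n ∈ volterraAlgebra ∧ Majorises (W ^ n) (Kn n)) ∧
        (∀ n, opComm S (Kn (n + 1)) = -(V * Kn n)) ∧
        Summable (fun n => ‖Kn (n + 1)‖) ∧
        HasSum (fun n => Kn (n + 1)) K := by
  choose! next hnext hcomm using fun n A (hA : A ∈ volterraAlgebra ∧ Majorises (W ^ n) A) =>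
    exists_next_term hV hWnonneg hmaj hA.1 hA.2
  let Kn : ℕ → Op := fun n => Nat.rec 1 next n
  have hKn : ∀ n, Kn n ∈ volterraAlgebra ∧ Majorises (W ^ n) (Kn n) := by
    intro n
    induction n with
    | zero => exact ⟨one_mem _, Majorises.one⟩
    | succ n ih => exact hnext n _ ih
  have hKn' : ∀ n, opComm S (Kn (n + 1)) = -(V * Kn n) := fun n => hcomm n _ (hKn n)
  have hWsum : Summable fun n => ‖W ^ (n + 1)‖ :=
    (summable_nat_add_iff 1).2 (summable_norm_pow_of_spectralRadius_lt_one hspr)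
  have hKsum : Summable fun n => ‖Kn (n + 1)‖ :=
    hWsum.of_nonneg_of_le (fun _ => norm_nonneg _) fun n => (hKn (n + 1)).2.norm_le
  obtain ⟨K, hK⟩ := hKsum.of_norm
  obtain ⟨T, hT⟩ := hWsum.of_norm
  have tendsto_apply : ∀ {u : ℕ → Op} {A : Op}, HasSum u A → ∀ f : L2,
      Filter.Tendsto (fun n => (∑ k ∈ Finset.range n, u k) f) Filter.atTop (nhds (A f)) :=
    fun h f => ((ContinuousLinearMap.apply ℂ L2 f).continuous.tendsto _).comp h.tendsto_sum_nat
  -- The majorant of `K` is `T = ∑ Wⁿ⁺¹`.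
  have hTK : Majorises T K := Majorises.of_tendsto
    (fun n => Majorises.sum fun k _ => (hKn (k + 1)).2) (tendsto_apply hK) (tendsto_apply hT)
  refine ⟨K, mem_volterraAlgebra_of_tendsto (fun n => sum_mem fun k _ => (hKn (k + 1)).1)
    (tendsto_apply hK), ⟨T, hTK.isNonnegOp, hTK⟩, ?_, Kn, rfl, hKn, hKn', hKsum, hK⟩
  have h1 : HasSum (fun n => -(V * Kn n)) (opComm S K) := by
    simpa only [← hKn', opComm] using (hK.mul_left S).sub (hK.mul_right S)
  have h2 : HasSum (fun n => -(V * Kn (n + 1))) (-(V * K)) := (hK.mul_left V).neg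
  -- Removing the term `-V K₀ = -V` from the series for `[S, K]` leaves `-V K`.
  have h3 := ((hasSum_nat_add_iff' 1).2 h1).unique h2
  have h4 : Kn 0 = 1 := rfl
  rw [Finset.sum_range_one, h4, mul_one, sub_neg_eq_add] at h3
  rw [add_right_comm, h3, neg_add_cancel]
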